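/- Let $\mathcal T$ be a triangulated category with suspension $\Sigma$. Let $(\alpha,\beta,\gamma)$ be a morphism from a distinguished triangle $X\xrightarrow{f}Y\xrightarrow{g}Z\xrightarrow{h}\Sigma X$ to a distinguished triangle $X'\xrightarrow{f'}Y'\xrightarrow{g'}Z'\xrightarrow{h'}\Sigma X'$, i.e. $\beta f=f'\alpha$, $\gamma g=g'\beta$ and $(\Sigma\alpha)h=h'\gamma$. The morphism $(\alpha,\beta,\gamma)$ is called *homotopic* if there are a distinguished triangle $X'\xrightarrow{s}E\xrightarrow{t}Z\xrightarrow{\eta}\Sigma X'$ and morphisms $\beta_1:Y\to E$, $\beta_2:E\to Y'$ with $\beta=\beta_2\beta_1$ such that $(\alpha,\beta_1,1_Z)$ is a morphism from $(f,g,h)$ to $(s,t,\eta)$, $(1_{X'},\beta_2,\gamma)$ is a morphism from $(s,t,\eta)$ to $(f',g',h')$, and $$X\xrightarrow{\binom{f}{\alpha}}Y\oplus X'\xrightarrow{(\beta_1,\,-s)}E\xrightarrow{ht}\Sigma X,\qquad E\xrightarrow{\binom{-t}{\beta_2}}Z\oplus Y'\xrightarrow{(\gamma,\,g')}Z'\xrightarrow{(\Sigma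 s)h'}\Sigma E$$ are distinguished triangles. The morphism $(\alpha,\beta,\gamma)$ is called *middling good* if there is a diagram $$\begin{array}{ccccccc} X&\xrightarrow{f}&Y&\xrightarrow{g}&Z&\xrightarrow{h}&\Sigma X\\ {\scriptstyle\alpha}\downarrow&&{\scriptstyle\beta}\downarrow&&{\scriptstyle\gamma}\downarrow&&\downarrow{\scriptstyle\Sigma\alpha}\\ X'&\xrightarrow{f'}&Y'&\xrightarrow{g'}&Z'&\xrightarrow{h'}&\Sigma X'\\ {\scriptstyle\alpha'}\downarrow&&{\scriptstyle\beta'}\downarrow&&{\scriptstyle\gamma'}\downarrow&&\downarrow{\scriptstyle\Sigma\alpha'}\\ X''&\xrightarrow{f''}&Y''&\xrightarrow{g''}&Z''&\xrightarrow{h''}&\Sigma X''\\ {\scriptstyle\alpha''}\downarrow&&{\scriptstyle\beta''}\downarrow&&{\scriptstyle\gamma''}\downarrow&&\downarrow{\scriptstyle-\Sigma\alpha''}\\ \Sigma X&\xrightarrow{\Sigma f}&\Sigma Y&\xrightarrow{\Sigma g}&\Sigma Z&\xrightarrow{-\Sigma h}&\Sigma^2X \end{array}$$ in which all rows and columns are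 distinguished triangles and all squares commute, except that the bottom right square satisfies $(\Sigma\alpha'')h''=-(\Sigma h)\gamma''$. Then: 1. Every homotopic morphism of distinguished triangles in $\mathcal T$ is middling good. 2. (Classical $4\times4$ lemma.) For any distinguished triangles $X\xrightarrow{f}Y\xrightarrow{g}Z\xrightarrow{h}\Sigma X$ and $X'\xrightarrow{f'}Y'\xrightarrow{g'}Z'\xrightarrow{h'}\Sigma X'$ in $\mathcal T$ and any morphisms $\alpha:X\to X'$, $\beta:Y\to Y'$ with $\beta f=f'\alpha$, there is a morphism $\gamma:Z\to Z'$ such that $(\alpha,\beta,\gamma)$ is a middling good morphism of distinguished triangles. -/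

import Mathlib

open CategoryTheory CategoryTheory.Limits CategoryTheory.Pretriangulated

universe v u

namespace TriangleMaps

section

variable {C : Type u} [Category.{v} C] [Preadditive C] [HasZeroObject C] [HasShift C ℤ]
  [∀ n : ℤ, (shiftFunctor C n).Additive] [Pretriangulated C]

/-- The extension group `𝔼(Z, X) = Hom(Z, ΣX)` of a triangulated category, regarded as an
extriangulated category. -/
abbrev Extension (Z X : C) := Z ⟶ X⟦(1 : ℤ)⟧

/-- The pullback `t^* δ = δ ∘ t ∈ 𝔼(W, X)` of `δ ∈ 𝔼(Z, X)` along `t : W ⟶ Z`. -/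
abbrev Extension.pullback {W Z X : C} (t : W ⟶ Z) (δ : Extension Z X) : Extension W X := t ≫ δ

/-- The pushforward `s_* δ = Σs ∘ δ ∈ 𝔼(Z, Y)` of `δ ∈ 𝔼(Z, X)` along `s : X ⟶ Y`. -/
abbrev Extension.pushforward {Z X Y : C} (s : X ⟶ Y) (δ : Extension Z X) : Extension Z Y :=
  δ ≫ s⟦(1 : ℤ)⟧'

/-- `X ⟶ Y ⟶ Z` together with `δ ∈ 𝔼(Z, X)` is an `𝔼`-triangle, that is, `X ⟶ Y ⟶ Z ⟶ ΣX` is a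
distinguished triangle. -/
abbrev IsExtTriangle {X Y Z : C} (f : X ⟶ Y) (g : Y ⟶ Z) (δ : Extension Z X) : Prop :=
  Triangle.mk f g δ ∈ distTriang C

/-- A morphism `φ = (α, β, γ)` from the distinguished triangle `T₁ = (f, g, h)` to the
distinguished triangle `T₂ = (f', g', h')`
is *homotopic* if there are a distinguished triangle `X' ⟶ E ⟶ Z ⟶ ΣX'` with morphisms `s`, `t`, `η`
and a factorization `β = β₂ ∘ β₁` through `E` such that `(α, β₁, 1)` is a morphism from `T₁` to
`(s, t, η)`, `(1, β₂, γ)` is a morphism from `(s, t, η)` to `T₂`, and both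
`X ⟶ Y ⊕ X' ⟶ E ⟶ ΣX`, with morphisms `(f, α)`, `(β₁, -s)`, `t^* h`, and
`E ⟶ Z ⊕ Y' ⟶ Z' ⟶ ΣE`, with morphisms `(-t, β₂)`, `(γ, g')`, `s_* h'`,
are distinguished triangles. -/
def IsHomotopic {T₁ T₂ : Triangle C} (φ : T₁ ⟶ T₂) : Prop :=
  ∃ (E : C) (s : T₂.obj₁ ⟶ E) (t : E ⟶ T₁.obj₃) (η : Extension T₁.obj₃ T₂.obj₁)
    (β₁ : T₁.obj₂ ⟶ E) (β₂ : E ⟶ T₂.obj₂),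
    IsExtTriangle s t η ∧
    -- `(α, β₁, 1)` is a morphism of triangles
    T₁.mor₁ ≫ β₁ = φ.hom₁ ≫ s ∧
    β₁ ≫ t = T₁.mor₂ ∧
    Extension.pushforward φ.hom₁ T₁.mor₃ = η ∧
    -- `(1, β₂, γ)` is a morphism of triangles
    s ≫ β₂ = T₂.mor₁ ∧
    β₂ ≫ T₂.mor₂ = t ≫ φ.hom₃ ∧
    η = Extension.pullback φ.hom₃ T₂.mor₃ ∧
    β₁ ≫ β₂ = φ.hom₂ ∧
    IsExtTriangle (biprod.lift T₁.mor₁ φ.hom₁) (biprod.desc β₁ (-s))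
      (Extension.pullback t T₁.mor₃) ∧
    IsExtTriangle (biprod.lift (-t) β₂) (biprod.desc φ.hom₃ T₂.mor₂)
      (Extension.pushforward s T₂.mor₃)

/-- A morphism `φ = (α, β, γ) : T₁ ⟶ T₂` of distinguished triangles is *middling good* if it is
the map between the first two rows of a `4 × 4` diagram
```
  X  ──f──> Y  ──g──> Z  ───h──> ΣX
  │α        │β        │γ         │Σα
  X' ──f'─> Y' ──g'─> Z' ──h'──> ΣX'
  │α'       │β'       │γ'        │Σα'
  X''──f''> Y''──g''> Z''──h''─> ΣX''
  │α''      │β''      │γ''       │-Σα''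
  ΣX ──Σf─> ΣY ──Σg─> ΣZ ─-Σh──> ΣΣX
```
in which all rows and columns are distinguished triangles and all squares commute, except for the
bottom right one, which satisfies `Σα'' ∘ h'' = -(Σh ∘ γ'')`. -/
def IsMiddlingGood {T₁ T₂ : Triangle C} (φ : T₁ ⟶ T₂) : Prop :=
  ∃ (T₃ : Triangle C)
    -- the squares between the second and the third row commute
    (φ' : T₂ ⟶ T₃)
    (α'' : T₃.obj₁ ⟶ T₁.obj₁⟦(1 : ℤ)⟧) (β'' : T₃.obj₂ ⟶ T₁.obj₂⟦(1 : ℤ)⟧)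
    (γ'' : T₃.obj₃ ⟶ T₁.obj₃⟦(1 : ℤ)⟧),
    -- the rows
    T₁ ∈ distTriang C ∧
    T₂ ∈ distTriang C ∧
    T₃ ∈ distTriang C ∧
    Triangle.mk (T₁.mor₁⟦(1 : ℤ)⟧') (T₁.mor₂⟦(1 : ℤ)⟧') (-T₁.mor₃⟦(1 : ℤ)⟧') ∈ distTriang C ∧
    -- the columns
    Triangle.mk φ.hom₁ φ'.hom₁ α'' ∈ distTriang C ∧
    Triangle.mk φ.hom₂ φ'.hom₂ β'' ∈ distTriang C ∧
    Triangle.mk φ.hom₃ φ'.hom₃ γ'' ∈ distTriang C ∧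
    Triangle.mk (φ.hom₁⟦(1 : ℤ)⟧') (φ'.hom₁⟦(1 : ℤ)⟧') (-α''⟦(1 : ℤ)⟧') ∈ distTriang C ∧
    -- the squares between the third and the fourth row
    T₃.mor₁ ≫ β'' = α'' ≫ T₁.mor₁⟦(1 : ℤ)⟧' ∧
    T₃.mor₂ ≫ γ'' = β'' ≫ T₁.mor₂⟦(1 : ℤ)⟧' ∧
    T₃.mor₃ ≫ α''⟦(1 : ℤ)⟧' = -(γ'' ≫ T₁.mor₃⟦(1 : ℤ)⟧')

end

end TriangleMaps

namespace TriangleMaps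

section

variable {C : Type u} [Category.{v} C] [Preadditive C] [HasZeroObject C] [HasShift C ℤ]
  [∀ n : ℤ, (shiftFunctor C n).Additive] [Pretriangulated C]

/-! Factor `β = β₂ ∘ β₁` through the homotopy pushout `E` of `f` and `α`. Then `β₁` inherits the
cone `X''` of `α` (`exists_column`), and `β₂` has the cone `Z''` of `γ`. The octahedron on this
factorization yields the third row `X'' ⟶ Y'' ⟶ Z''` (`isMiddlingGood_of_factorization`). A
homotopic morphism supplies `E`, and its second homotopy cartesian square gives the cone of `β₂`.
When only `α` and `β` are given, `E` is constructed, and an octahedron on `f' = β₂ ∘ s` produces `γ`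
together with the cone it shares with `β₂`. -/

lemma distinguished_of_iso {X Y Z X' Y' Z' : C} {f : X ⟶ Y} {g : Y ⟶ Z} {h : Z ⟶ X⟦(1 : ℤ)⟧}
    (H : Triangle.mk f g h ∈ distTriang C)
    {f' : X' ⟶ Y'} {g' : Y' ⟶ Z'} {h' : Z' ⟶ X'⟦(1 : ℤ)⟧} (e₁ : X' ≅ X) (e₂ : Y' ≅ Y) (e₃ : Z' ≅ Z)
    (hf : f' ≫ e₂.hom = e₁.hom ≫ f) (hg : g' ≫ e₃.hom = e₂.hom ≫ g)
    (hh : h' ≫ e₁.hom⟦(1 : ℤ)⟧' = e₃.hom ≫ h) : Triangle.mk f' g' h' ∈ distTriang C :=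
  isomorphic_distinguished _ H _ (Triangle.isoMk _ _ e₁ e₂ e₃ hf hg hh)

lemma distinguished_neg₁₃ {X Y Z : C} {f : X ⟶ Y} {g : Y ⟶ Z} {h : Z ⟶ X⟦(1 : ℤ)⟧}
    (H : Triangle.mk f g h ∈ distTriang C) : Triangle.mk (-f) g (-h) ∈ distTriang C :=
  distinguished_of_iso H (-Iso.refl _) (Iso.refl _) (Iso.refl _)
    (by simp) (by simp) (by simp [Functor.map_neg])

lemma distinguished_neg₂₃ {X Y Z : C} {f : X ⟶ Y} {g : Y ⟶ Z} {h : Z ⟶ X⟦(1 : ℤ)⟧}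
    (H : Triangle.mk f g h ∈ distTriang C) : Triangle.mk f (-g) (-h) ∈ distTriang C :=
  distinguished_of_iso H (Iso.refl _) (Iso.refl _) (-Iso.refl _) (by simp) (by simp) (by simp)

lemma distinguished_rotate_iff {X Y Z : C} {f : X ⟶ Y} {g : Y ⟶ Z} {h : Z ⟶ X⟦(1 : ℤ)⟧} :
    Triangle.mk g h (-f⟦(1 : ℤ)⟧') ∈ distTriang C ↔ Triangle.mk f g h ∈ distTriang C :=
  (rotate_distinguished_triangle (Triangle.mk f g h)).symm

/-- The suspension of a distinguished triangle, with the sign on its third morphism. -/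
lemma distinguished_suspension {X Y Z : C} {f : X ⟶ Y} {g : Y ⟶ Z} {h : Z ⟶ X⟦(1 : ℤ)⟧}
    (H : Triangle.mk f g h ∈ distTriang C) :
    Triangle.mk (f⟦(1 : ℤ)⟧') (g⟦(1 : ℤ)⟧') (-h⟦(1 : ℤ)⟧') ∈ distTriang C :=
  distinguished_of_iso
    (distinguished_rotate_iff.mpr (distinguished_rotate_iff.mpr (distinguished_rotate_iff.mpr H)))
    (Iso.refl _) (-Iso.refl _) (Iso.refl _) (by simp) (by simp) (by simp)

lemma inl_snd_distinguished (A B : C) :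
    Triangle.mk (biprod.inl : A ⟶ A ⊞ B) (biprod.snd : A ⊞ B ⟶ B) (0 : B ⟶ A⟦(1 : ℤ)⟧) ∈
      distTriang C :=
  binaryBiproductTriangle_distinguished A B

lemma inr_fst_distinguished (A B : C) :
    Triangle.mk (biprod.inr : B ⟶ A ⊞ B) (biprod.fst : A ⊞ B ⟶ A) (0 : A ⟶ B⟦(1 : ℤ)⟧) ∈
      distTriang C :=
  distinguished_of_iso (inl_snd_distinguished B A) (Iso.refl _) (biprod.braiding A B)
    (Iso.refl _) (by ext <;> simp) (by simp) (by simp)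

variable [IsTriangulated C]

/-- In a distinguished triangle `X ⟶ U ⟶ E ⟶ ΣX` whose middle term is a direct sum of `A` and `B`,
the cone of the component `X ⟶ B` is also a cone of the component `A ⟶ E`. -/
lemma exists_cone_of_component {X U A B E W : C} {k : X ⟶ U} {l : U ⟶ E}
    {d : E ⟶ X⟦(1 : ℤ)⟧} (hkl : Triangle.mk k l d ∈ distTriang C)
    {i : A ⟶ U} {p : U ⟶ B} (hip : Triangle.mk i p 0 ∈ distTriang C)
    {r : U ⟶ A} (hr : i ≫ r = 𝟙 A) {b : X ⟶ B} (hb : k ≫ p = b)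
    {b' : B ⟶ W} {b'' : W ⟶ X⟦(1 : ℤ)⟧} (hW : Triangle.mk b b' b'' ∈ distTriang C) :
    ∃ m : E ⟶ W, l ≫ m = p ≫ b' ∧ m ≫ b'' = d ∧
      Triangle.mk (i ≫ l) m (-(b'' ≫ (k ≫ r)⟦(1 : ℤ)⟧')) ∈ distTriang C := by
  obtain ⟨o⟩ := IsTriangulated.octahedron_axiom hb hkl (distinguished_rotate_iff.mpr hip) hW
  refine ⟨o.m₁, o.comm₁, o.comm₂, ?_⟩
  -- The octahedron only gives `o.m₃` after composition with `-Σi`; the retraction `r` of `i`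
  -- recovers it.
  have h₃ : -(b'' ≫ (k ≫ r)⟦(1 : ℤ)⟧') = o.m₃ := by
    have h := o.comm₄ =≫ r⟦(1 : ℤ)⟧'
    simp only [Category.assoc, ← Functor.map_comp, Preadditive.neg_comp, Preadditive.comp_neg,
      hr] at h
    rw [h, neg_neg, CategoryTheory.Functor.map_id, Category.comp_id]
  rw [h₃]
  refine distinguished_rotate_iff.mp ?_
  have hm := o.mem
  simp only [Preadditive.neg_comp, ← Functor.map_comp] at hm
  exact hm

/-- The cone of a map `γ : Z ⟶ Z'` that fits in a homotopy cartesian square with `β₂ : E ⟶ Y'`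
is also a cone of `β₂`. -/
lemma exists_cone_of_homotopyCartesian {E Y' Z Z' X' W : C} {s : X' ⟶ E} {t : E ⟶ Z}
    {β₂ : E ⟶ Y'} {γ : Z ⟶ Z'} {g' : Y' ⟶ Z'} {h' : Z' ⟶ X'⟦(1 : ℤ)⟧}
    (H : Triangle.mk (biprod.lift (-t) β₂) (biprod.desc γ g') (h' ≫ s⟦(1 : ℤ)⟧') ∈ distTriang C)
    {γ' : Z' ⟶ W} {γ'' : W ⟶ Z⟦(1 : ℤ)⟧} (hγ : Triangle.mk γ γ' γ'' ∈ distTriang C) :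
    ∃ q : W ⟶ E⟦(1 : ℤ)⟧, Triangle.mk β₂ (g' ≫ γ') q ∈ distTriang C ∧
      γ' ≫ q = h' ≫ s⟦(1 : ℤ)⟧' ∧ q ≫ t⟦(1 : ℤ)⟧' = γ'' := by
  obtain ⟨o⟩ := IsTriangulated.octahedron_axiom (biprod.inl_desc γ g')
    (inl_snd_distinguished Z Y') (distinguished_rotate_iff.mpr H) hγ
  have hm₁ : o.m₁ = g' ≫ γ' := by
    simpa using biprod.inr ≫= o.comm₁
  refine ⟨o.m₃, ?_, o.comm₃, ?_⟩
  · refine distinguished_rotate_iff.mp ?_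
    have hm := o.mem
    simp only [Preadditive.neg_comp, ← Functor.map_comp, biprod.lift_snd,
      hm₁] at hm
    exact hm
  · have h := o.comm₄ =≫ (biprod.fst : Z ⊞ Y' ⟶ Z)⟦(1 : ℤ)⟧'
    simp only [Category.assoc, ← Functor.map_comp, Preadditive.neg_comp, Preadditive.comp_neg,
      biprod.lift_fst, biprod.inl_fst, Functor.map_neg, neg_neg] at h
    rw [← h, CategoryTheory.Functor.map_id, Category.comp_id]

/-- The octahedron on a factorization of the middle component completes a morphism of
distinguished triangles to a `4 × 4` diagram, given compatible cones of both factors. -/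
lemma isMiddlingGood_of_factorization {T₁ T₂ : Triangle C} (hT₁ : T₁ ∈ distTriang C)
    (hT₂ : T₂ ∈ distTriang C) (φ : T₁ ⟶ T₂) {E X'' Z'' : C}
    {s : T₂.obj₁ ⟶ E} {t : E ⟶ T₁.obj₃} {β₁ : T₁.obj₂ ⟶ E} {β₂ : E ⟶ T₂.obj₂}
    (hβ : β₁ ≫ β₂ = φ.hom₂) (ht : β₁ ≫ t = T₁.mor₂) (hs : s ≫ β₂ = T₂.mor₁)
    {α' : T₂.obj₁ ⟶ X''} {α'' : X'' ⟶ T₁.obj₁⟦(1 : ℤ)⟧}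
    (hα : Triangle.mk φ.hom₁ α' α'' ∈ distTriang C)
    {γ' : T₂.obj₃ ⟶ Z''} {γ'' : Z'' ⟶ T₁.obj₃⟦(1 : ℤ)⟧}
    (hγ : Triangle.mk φ.hom₃ γ' γ'' ∈ distTriang C)
    {p : E ⟶ X''} (hp : Triangle.mk β₁ p (α'' ≫ T₁.mor₁⟦(1 : ℤ)⟧') ∈ distTriang C)
    (hsp : s ≫ p = α') (hpα : p ≫ α'' = -(t ≫ T₁.mor₃))
    {q : Z'' ⟶ E⟦(1 : ℤ)⟧} (hq : Triangle.mk β₂ (T₂.mor₂ ≫ γ') q ∈ distTriang C)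
    (hγq : γ' ≫ q = T₂.mor₃ ≫ s⟦(1 : ℤ)⟧') (hqt : q ≫ t⟦(1 : ℤ)⟧' = γ'') :
    IsMiddlingGood φ := by
  obtain ⟨Y'', β', β'', hβ'⟩ := distinguished_cocone_triangle φ.hom₂
  obtain ⟨o⟩ := IsTriangulated.octahedron_axiom hβ hp hq hβ'
  have h₁ : T₂.mor₁ ≫ β' = α' ≫ o.m₁ := by
    rw [← hsp, ← hs, Category.assoc, Category.assoc, o.comm₁]
  have h₃ : T₂.mor₃ ≫ α'⟦(1 : ℤ)⟧' = γ' ≫ q ≫ p⟦(1 : ℤ)⟧' := by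
    rw [reassoc_of% hγq, ← Functor.map_comp, hsp]
  have h₅ : o.m₃ ≫ γ'' = β'' ≫ T₁.mor₂⟦(1 : ℤ)⟧' := by
    rw [← hqt, ← ht, Functor.map_comp, reassoc_of% o.comm₄]
  -- The sign of the bottom right square is the sign in `hpα`.
  have h₆ : (q ≫ p⟦(1 : ℤ)⟧') ≫ α''⟦(1 : ℤ)⟧' = -(γ'' ≫ T₁.mor₃⟦(1 : ℤ)⟧') := by
    rw [Category.assoc, ← Functor.map_comp, hpα, ← hqt, Functor.map_neg, Functor.map_comp,
      Preadditive.comp_neg, Category.assoc]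
  exact ⟨Triangle.mk o.m₁ o.m₃ (q ≫ p⟦(1 : ℤ)⟧'),
    Triangle.homMk _ _ α' β' γ' h₁ o.comm₃.symm h₃,
    α'', β'', γ'', hT₁, hT₂, o.mem, distinguished_suspension hT₁, hα, hβ', hγ,
    distinguished_suspension hα, o.comm₂, h₅, h₆⟩

/-- The column `Y ⟶ E ⟶ X''` induced by a homotopy cartesian square and the cone of `α`. -/
lemma exists_column {X Y X' E Z X'' : C} {f : X ⟶ Y} {α : X ⟶ X'} {β₁ : Y ⟶ E} {s : X' ⟶ E}
    {t : E ⟶ Z} {h : Z ⟶ X⟦(1 : ℤ)⟧}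
    (H : Triangle.mk (biprod.lift f α) (biprod.desc β₁ (-s)) (t ≫ h) ∈ distTriang C)
    {α' : X' ⟶ X''} {α'' : X'' ⟶ X⟦(1 : ℤ)⟧} (hα : Triangle.mk α α' α'' ∈ distTriang C) :
    ∃ p : E ⟶ X'', Triangle.mk β₁ p (α'' ≫ f⟦(1 : ℤ)⟧') ∈ distTriang C ∧ s ≫ p = α' ∧
      p ≫ α'' = -(t ≫ h) := by
  obtain ⟨m, hm₁, hm₂, hm⟩ := exists_cone_of_component H
    (inl_snd_distinguished Y X') biprod.inl_fst (biprod.lift_snd f α) hα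
  -- The second component of `Y ⊞ X' ⟶ E` is `-s`, so `m` restricts along `s` to `-α'`; hence `p =
  -- -m`.
  refine ⟨-m, ?_, ?_, by simp [hm₂]⟩
  · simpa using distinguished_neg₂₃ hm
  · simpa using biprod.inr ≫= hm₁

theorem isMiddlingGood_of_isHomotopic {T₁ T₂ : Triangle C} (hT₁ : T₁ ∈ distTriang C)
    (hT₂ : T₂ ∈ distTriang C) (φ : T₁ ⟶ T₂) (hφ : IsHomotopic φ) : IsMiddlingGood φ := by
  obtain ⟨E, s, t, η, β₁, β₂, -, -, ht, -, hs, -, -, hβ, H₁, H₂⟩ := hφ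
  obtain ⟨X'', α', α'', hα⟩ := distinguished_cocone_triangle φ.hom₁
  obtain ⟨Z'', γ', γ'', hγ⟩ := distinguished_cocone_triangle φ.hom₃
  obtain ⟨p, hp, hsp, hpα⟩ := exists_column H₁ hα
  obtain ⟨q, hq, hγq, hqt⟩ := exists_cone_of_homotopyCartesian H₂ hγ
  exact isMiddlingGood_of_factorization hT₁ hT₂ φ hβ ht hs hα hγ hp hsp hpα hq hγq hqt

theorem exists_isMiddlingGood {T₁ T₂ : Triangle C} (hT₁ : T₁ ∈ distTriang C)
    (hT₂ : T₂ ∈ distTriang C) (α : T₁.obj₁ ⟶ T₂.obj₁) (β : T₁.obj₂ ⟶ T₂.obj₂)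
    (comm : T₁.mor₁ ≫ β = α ≫ T₂.mor₁) :
    ∃ φ : T₁ ⟶ T₂, φ.hom₁ = α ∧ φ.hom₂ = β ∧ IsMiddlingGood φ := by
  obtain ⟨E, l, d, hE⟩ := distinguished_cocone_triangle (biprod.lift T₁.mor₁ α)
  obtain ⟨β₁, s, rfl⟩ : ∃ (β₁ : T₁.obj₂ ⟶ E) (s : T₂.obj₁ ⟶ E), l = biprod.desc β₁ (-s) :=
    ⟨biprod.inl ≫ l, -(biprod.inr ≫ l), by ext <;> simp⟩
  -- Projecting to `Y` instead of `X'` shows that `s` inherits the cone of `f`.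
  obtain ⟨t, ht, rfl, hst⟩ := exists_cone_of_component hE
    (inr_fst_distinguished T₁.obj₂ T₂.obj₁) biprod.inr_snd (biprod.lift_fst T₁.mor₁ α) hT₁
  have hβ₁t : β₁ ≫ t = T₁.mor₂ := by simpa using biprod.inl ≫= ht
  replace hst : Triangle.mk s t (T₁.mor₃ ≫ α⟦(1 : ℤ)⟧') ∈ distTriang C := by
    simpa using distinguished_neg₁₃ hst
  -- Weak pushout property of `E`, applied to the commutative square `comm`.
  obtain ⟨β₂, hβ₂⟩ : ∃ β₂ : E ⟶ T₂.obj₂,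
      biprod.desc β (-T₂.mor₁) = biprod.desc β₁ (-s) ≫ β₂ :=
    Triangle.yoneda_exact₂ _ hE (biprod.desc β (-T₂.mor₁))
      (show biprod.lift T₁.mor₁ α ≫ biprod.desc β (-T₂.mor₁) = 0 by simp [comm])
  have hβ : β₁ ≫ β₂ = β := by simpa using (biprod.inl ≫= hβ₂).symm
  have hs : s ≫ β₂ = T₂.mor₁ := by simpa using (biprod.inr ≫= hβ₂).symm
  obtain ⟨Z'', w, q, hq⟩ := distinguished_cocone_triangle β₂
  -- Here `o.m₁ : Z ⟶ Z'` is the required `γ`, and `o.mem` makes `Z''` its cone.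
  obtain ⟨o⟩ := IsTriangulated.octahedron_axiom hs hst hq hT₂
  obtain ⟨X'', α', α'', hα⟩ := distinguished_cocone_triangle α
  obtain ⟨p, hp, hsp, hpα⟩ := exists_column hE hα
  have hγ : T₁.mor₂ ≫ o.m₁ = β ≫ T₂.mor₂ := by
    rw [← hβ₁t, ← hβ, Category.assoc, Category.assoc, o.comm₁]
  rw [← o.comm₃] at hq
  exact ⟨Triangle.homMk _ _ α β o.m₁ comm hγ o.comm₂.symm, rfl, rfl,
    isMiddlingGood_of_factorization hT₁ hT₂ _ hβ hβ₁t hs hα o.mem hp hsp hpα hq o.comm₄.symm rfl⟩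

end

end TriangleMaps

theorem proposition6p1 (C : Type u) [Category.{v} C] [Preadditive C] [HasZeroObject C]
    [HasShift C ℤ] [∀ n : ℤ, (shiftFunctor C n).Additive] [Pretriangulated C]
    [IsTriangulated C] :
    (∀ (T₁ T₂ : Triangle C), T₁ ∈ distTriang C → T₂ ∈ distTriang C →
      ∀ φ : T₁ ⟶ T₂, TriangleMaps.IsHomotopic φ → TriangleMaps.IsMiddlingGood φ) ∧
    (∀ (T₁ T₂ : Triangle C), T₁ ∈ distTriang C → T₂ ∈ distTriang C →
      ∀ (α : T₁.obj₁ ⟶ T₂.obj₁) (β : T₁.obj₂ ⟶ T₂.obj₂), T₁.mor₁ ≫ β = α ≫ T₂.mor₁ →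
      ∃ φ : T₁ ⟶ T₂, φ.hom₁ = α ∧ φ.hom₂ = β ∧ TriangleMaps.IsMiddlingGood φ) :=
  ⟨fun _ _ hT₁ hT₂ φ hφ => TriangleMaps.isMiddlingGood_of_isHomotopic hT₁ hT₂ φ hφ,
    fun _ _ hT₁ hT₂ α β comm => TriangleMaps.exists_isMiddlingGood hT₁ hT₂ α β comm⟩
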